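/- Let $m \ge 2$ be an integer, let $k$ be an infinite field, and let $\Gamma = PSL_m(k) = SL_m(k)/Z(SL_m(k))$, regarded as a discrete group. (a) Let $(X,\mu)$ be a probability space whose $\sigma$-algebra contains a countable family of sets separating the points of $X$ (for example a standard probability space), and let $\Gamma$ act on $X$ by measurable, $\mu$-preserving maps. Suppose that the action is ergodic, i.e. every measurable $A \subseteq X$ with $\mu(gA \,\triangle\, A) = 0$ for all $g \in \Gamma$ satisfies $\mu(A) \in \{0,1\}$. If the action is non-trivial, i.e. some $g \in \Gamma$ does not act as the identity $\mu$-almost everywhere, then it is essentially free, i.e. $\mu(\{x \in X \mid gx = x\}) = 0$ for every $g \in \Gamma \setminus \{e\}$. (b) $\Gamma$ has no non-trivial ergodic invariant random subgroups: let $\mathrm{Sub}(\Gamma)$ be the space of subgroups of $\Gamma$ with the Chabauty topology, which is generated by the sets $\{\Lambda \mid g \in \Lambda\}$ and $\{\Lambda \mid g \notin \Lambda\}$, $g \in \Gamma$. Then every regular Borel probability measure on $\mathrm{Sub}(\Gamma)$ that is invariant and ergodic under conjugation by $\Gamma$ is the point mass at the trivial subgroup $\{e\}$ or the point mass at $\Gamma$.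 (Regularity is automatic if $k$ is countable.) -/

import Mathlib

open MeasureTheory
open scoped Pointwise MatrixGroups

section Actions

variable (G : Type*) {X : Type*} [Group G] [MulAction G X] [MeasurableSpace X]

/-- The action of `G` on `(X, μ)` is trivial: every group element acts as the identity
up to a null set, i.e. the homomorphism from `G` to `Aut (X, μ)` is trivial. -/
def IsTrivialAction (μ : Measure X) : Prop :=
  ∀ g : G, ∀ᵐ x ∂μ, g • x = x

/-- The action of `G` on `(X, μ)` is essentially free: every `g ≠ 1` has a null set
of fixed points. -/
def IsEssentiallyFree (μ : Measure X) : Prop :=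
  ∀ g : G, g ≠ 1 → μ (MulAction.fixedBy X g) = 0

end Actions

section Chabauty

variable (G : Type*) [Group G]

/-- The Chabauty topology on the space of subgroups of the discrete group `G`: it is
generated by the sets of subgroups that contain, respectively omit, a given element. -/
instance chabautyTopology : TopologicalSpace (Subgroup G) :=
  TopologicalSpace.generateFrom
    {s | ∃ g : G, s = {H : Subgroup G | g ∈ H} ∨ s = {H : Subgroup G | g ∉ H}}

/-- The Borel structure of the Chabauty space. -/
instance chabautyMeasurableSpace : MeasurableSpace (Subgroup G) := borel (Subgroup G)

instance chabautyBorelSpace : BorelSpace (Subgroup G) := ⟨rfl⟩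

variable {G}

/-- An ergodic invariant random subgroup of the discrete group `G`: a regular Borel probability
measure on the Chabauty space that is invariant and ergodic for the conjugation action
of `G` on its subgroups. (If `G` is countable then the Chabauty space is compact and metrizable
and regularity is automatic.) -/
structure IsErgodicIRS (μ : Measure (Subgroup G)) : Prop where
  isProbabilityMeasure : IsProbabilityMeasure μ
  regular : μ.Regular
  ergodic : ErgodicSMul (ConjAct G) (Subgroup G) μ

end Chabauty

/-! Both parts concern an equivariant random subgroup `Λ x` of `SL`: the preimage of a stabilizer in
(a), of a random point of the Chabauty space in (b). It suffices that, for noncentral `g`,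
membership of `g` in `Λ x` almost surely forces that of any given `h`; ergodicity then gives a
zero-one law. Since `g` and `h` have finitely many entries, this can be checked over a countable
infinite subfield.

The engine is Poincaré recurrence. If `g` lies in both `Λ x` and `Λ (ρ h • x)`, then `Λ x` contains
the commutator `g⁻¹ * (h⁻¹ * g * h)`. If such commutators force `h` into a subgroup `V x` that is
constant along orbits, then `V x` has finite index almost everywhere on this event. In `SL(2, K)`
this is used for the torus and then for the unipotent group, and an additive subgroup of finite
index stable under infinitely many scalars is all of `K`. In `SL n K`, recurrence along a
transvection group yields a nontrivial commutator inside a copy of `SL(2, K)`, so `Λ x` contains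
that transvection group, then every transvection, hence everything. -/

/-! ### Recurrence with return times in a subgroup. -/

section Recurrence

variable {G H H' X : Type*} [Group G] [Group H] [Group H'] [MulAction G X] [MeasurableSpace X]

/-- An equivariant measurable family of subgroups of `H`, where `H` acts through `ρ`. -/
structure IsRandomSubgroup (ρ : H →* G) (Λ : X → Subgroup H) : Prop where
  measurableSet_mem : ∀ h, MeasurableSet {x | h ∈ Λ x}
  mem_smul : ∀ h h' x, h' ∈ Λ (ρ h • x) ↔ h⁻¹ * h' * h ∈ Λ x

theorem IsRandomSubgroup.comap {ρ : H →* G} {Λ : X → Subgroup H} (hΛ : IsRandomSubgroup ρ Λ)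
    (σ : H' →* H) : IsRandomSubgroup (ρ.comp σ) (fun x => (Λ x).comap σ) where
  measurableSet_mem h := hΛ.measurableSet_mem (σ h)
  mem_smul h h' x := by simp [hΛ.mem_smul]

variable [MeasurableConstSMul G X] {μ : Measure X} [SMulInvariantMeasure G X μ]

/-- The points `x` for which the elements of `S` lie in distinct left cosets of `V x`. -/
def separatedSet (V : X → Subgroup H) (S : Finset H) : Set X :=
  {x | ∀ s ∈ S, ∀ t ∈ S, s⁻¹ * t ∈ V x → s = t}

theorem measurableSet_separatedSet {V : X → Subgroup H} (hVm : ∀ h, MeasurableSet {x | h ∈ V x})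
    (S : Finset H) : MeasurableSet (separatedSet V S) := by
  have : separatedSet V S = ⋂ s ∈ S, ⋂ t ∈ S, ({x | s⁻¹ * t ∈ V x}ᶜ ∪ {_x | s = t}) := by
    ext x
    simp [separatedSet, imp_iff_not_or]
  rw [this]
  exact Finset.measurableSet_biInter _ fun s _ => Finset.measurableSet_biInter _ fun t _ =>
    (hVm _).compl.union (MeasurableSet.const _)

/-- The translates of `F ∩ Y` by `S` have equal measure and lie in `Y`. They are disjoint: a point
common to those of `s` and `t` gives the return time `t⁻¹ * s`, which then lies in `V x`. -/
theorem card_mul_measure_inter_le (ρ : H →* G) {V : X → Subgroup H}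
    (hV : ∀ h x, V (ρ h • x) = V x) {F : Set X} (hF : MeasurableSet F)
    (hret : ∀ x ∈ F, ∀ h, ρ h • x ∈ F → h ∈ V x) {S : Finset H} {Y : Set X}
    (hY : MeasurableSet Y) (hYinv : ∀ h x, ρ h • x ∈ Y ↔ x ∈ Y) (hYS : Y ⊆ separatedSet V S) :
    S.card * μ (F ∩ Y) ≤ μ Y := by
  have hmeas : ∀ s ∈ S, MeasurableSet ((fun x => ρ s⁻¹ • x) ⁻¹' (F ∩ Y)) := fun s _ =>
    measurable_const_smul (ρ s⁻¹) (hF.inter hY)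
  have hdisj : (S : Set H).PairwiseDisjoint fun s => (fun x => ρ s⁻¹ • x) ⁻¹' (F ∩ Y) := by
    intro s hs t ht hst
    refine Set.disjoint_left.2 fun x hxs hxt => hst ?_
    have h1 : s ∈ S := hs
    have h2 : t ∈ S := ht
    have hx : x ∈ Y := (hYinv _ _).1 hxs.2
    have := hret (ρ s⁻¹ • x) hxs.1 (t⁻¹ * s) (by
      rw [smul_smul, ← map_mul]
      simpa using hxt.1)
    rw [hV] at this
    exact (hYS hx t h2 s h1 this).symm
  calc S.card * μ (F ∩ Y) = ∑ s ∈ S, μ ((fun x => ρ s⁻¹ • x) ⁻¹' (F ∩ Y)) := by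
        rw [Finset.sum_congr rfl fun s _ => measure_preimage_smul_of_nullMeasurableSet
          (hF.inter hY).nullMeasurableSet (ρ s⁻¹)]
        simp
    _ = μ (⋃ s ∈ S, (fun x => ρ s⁻¹ • x) ⁻¹' (F ∩ Y)) := (measure_biUnion_finset hdisj hmeas).symm
    _ ≤ μ Y := by
        refine measure_mono (Set.iUnion₂_subset fun s _ x hx => ?_)
        exact (hYinv _ _).1 hx.2

theorem mul_measure_inter_iUnion_separatedSet_le (ρ : H →* G) {V : X → Subgroup H}
    (hVm : ∀ h, MeasurableSet {x | h ∈ V x})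
    (hV : ∀ h x, V (ρ h • x) = V x) {F : Set X} (hF : MeasurableSet F)
    (hret : ∀ x ∈ F, ∀ h, ρ h • x ∈ F → h ∈ V x) (N : ℕ) (S : ℕ → Finset H)
    (hS : ∀ i, (S i).card = N) :
    N * μ (F ∩ ⋃ i, separatedSet V (S i)) ≤ μ Set.univ := by
  have hm i := measurableSet_separatedSet hVm (S i)
  have hinv : ∀ i h x, ρ h • x ∈ separatedSet V (S i) ↔ x ∈ separatedSet V (S i) := by
    intro i h x
    simp [separatedSet, hV]
  -- Disjoint invariant pieces let the bounds be summed.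
  let Y := disjointed fun i => separatedSet V (S i)
  have hYm : ∀ i, MeasurableSet (Y i) := fun i => MeasurableSet.disjointed hm i
  have hYinv : ∀ i h x, ρ h • x ∈ Y i ↔ x ∈ Y i := by
    intro i h x
    simp [Y, disjointed_eq_inter_compl, hinv]
  calc N * μ (F ∩ ⋃ i, separatedSet V (S i)) = N * μ (⋃ i, F ∩ Y i) := by
        rw [← iUnion_disjointed, Set.inter_iUnion]
    _ ≤ N * ∑' i, μ (F ∩ Y i) := by gcongr; exact measure_iUnion_le _
    _ = ∑' i, N * μ (F ∩ Y i) := ENNReal.tsum_mul_left.symm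
    _ ≤ ∑' i, μ (Y i) := ENNReal.tsum_le_tsum fun i => by
        rw [← hS i]
        exact card_mul_measure_inter_le ρ hV hF hret (hYm i) (hYinv i) (disjointed_subset _ i)
    _ = μ (⋃ i, Y i) := (measure_iUnion (disjoint_disjointed _) hYm).symm
    _ ≤ μ Set.univ := measure_mono (Set.subset_univ _)

/-- A quantitative form of Poincaré recurrence: if the return times to `F` are contained in an
invariant measurable family of subgroups, then these have finite index almost everywhere on `F`. -/
theorem ae_finiteIndex_of_return [Countable H] [IsFiniteMeasure μ] (ρ : H →* G)
    {V : X → Subgroup H} (hVm : ∀ h, MeasurableSet {x | h ∈ V x})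
    (hV : ∀ h x, V (ρ h • x) = V x) {F : Set X} (hF : MeasurableSet F)
    (hret : ∀ x ∈ F, ∀ h, ρ h • x ∈ F → h ∈ V x) :
    ∀ᵐ x ∂μ, x ∈ F → (V x).FiniteIndex := by
  have key : ∀ N : ℕ, N * μ {x | ¬ (x ∈ F → (V x).FiniteIndex)} ≤ μ Set.univ := by
    intro N
    -- If `H` has no `N` elements it is finite, and every subgroup has finite index.
    by_cases hne : Nonempty {S : Finset H // S.card = N}
    · obtain ⟨S, hS⟩ := exists_surjective_nat {S : Finset H // S.card = N}
      refine le_trans ?_ (mul_measure_inter_iUnion_separatedSet_le (μ := μ) ρ hVm hV hF hret N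
        (fun i => (S i).1) fun i => (S i).2)
      gcongr
      intro x hx
      simp only [Set.mem_ofPred_eq, Classical.not_imp] at hx
      refine ⟨hx.1, ?_⟩
      have hinf : Infinite (H ⧸ V x) := by
        by_contra hfin
        rw [not_infinite_iff_finite] at hfin
        exact hx.2 Subgroup.finiteIndex_of_finite_quotient
      obtain ⟨T, hT⟩ := Infinite.exists_subset_card_eq (H ⧸ V x) N
      obtain ⟨i, hi⟩ := hS ⟨T.map ⟨Quotient.out, Quotient.out_injective⟩, by simpa using hT⟩
      refine Set.mem_iUnion.2 ⟨i, ?_⟩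
      simp only [hi, separatedSet, Set.mem_ofPred_eq, Finset.mem_map]
      rintro _ ⟨s, -, rfl⟩ _ ⟨t, -, rfl⟩ hst
      have := QuotientGroup.eq.2 hst
      simp only [Function.Embedding.coeFn_mk, QuotientGroup.out_eq'] at this
      simp [this]
    · have : {x | ¬ (x ∈ F → (V x).FiniteIndex)} = ∅ := by
        refine Set.eq_empty_of_forall_notMem fun x hx => ?_
        simp only [Set.mem_ofPred_eq, Classical.not_imp] at hx
        have : Finite H := by
          by_contra hinf
          rw [not_finite_iff_infinite] at hinf
          obtain ⟨S, hS⟩ := Infinite.exists_subset_card_eq H N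
          exact hne ⟨S, hS⟩
        exact hx.2 inferInstance
      rw [this]; simp
  rw [ae_iff]
  by_contra h0
  have htop : μ {x | ¬ (x ∈ F → (V x).FiniteIndex)} ≠ ⊤ := measure_ne_top _ _
  obtain ⟨N, hN⟩ := ENNReal.exists_nat_mul_gt h0 (measure_ne_top μ Set.univ)
  exact (key N).not_gt hN

/-- Points of `F` that never return have return times in the trivial subgroup, which has infinite
index. -/
theorem ae_exists_ne_one_smul_mem [Countable H] [Infinite H] [IsFiniteMeasure μ] (ρ : H →* G)
    {F : Set X} (hF : MeasurableSet F) :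
    ∀ᵐ x ∂μ, x ∈ F → ∃ h : H, h ≠ 1 ∧ ρ h • x ∈ F := by
  let F' : Set X := F ∩ ⋂ h ∈ ({1}ᶜ : Set H), (fun x => ρ h • x) ⁻¹' Fᶜ
  have hF' : MeasurableSet F' := hF.inter <| MeasurableSet.biInter (Set.to_countable _) fun h _ =>
    measurable_const_smul (ρ h) hF.compl
  have := ae_finiteIndex_of_return (μ := μ) ρ (V := fun _ => (⊥ : Subgroup H))
    (fun h => MeasurableSet.const _) (fun _ _ => rfl) hF' (by
      intro x hx h hxh
      by_contra hne
      have := Set.mem_iInter₂.1 hx.2 h hne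
      exact this hxh.1)
  filter_upwards [this] with x hx hxF
  by_contra! hcon
  have hfi := hx ⟨hxF, Set.mem_iInter₂.2 fun h hh => hcon h hh⟩
  have : Finite (H ⧸ (⊥ : Subgroup H)) := inferInstance
  have : Finite H := Finite.of_equiv _ (QuotientGroup.quotientBot (G := H)).toEquiv
  exact not_finite H

end Recurrence

/-! ### Random subgroups of `SL(2, K)`. -/

section RankOne

variable {K : Type*} [Field K]

/-- The upper unipotent one-parameter subgroup of `SL(2, K)`. -/
def upperHom (K : Type*) [Field K] : Multiplicative K →* SL(2, K) where
  toFun t := ⟨!![1, t.toAdd; 0, 1], by simp [Matrix.det_fin_two]⟩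
  map_one' := by ext i j; fin_cases i <;> fin_cases j <;> simp
  map_mul' s t := by
    apply Subtype.ext
    change !![1, s.toAdd + t.toAdd; 0, 1] = !![1, s.toAdd; 0, 1] * !![1, t.toAdd; 0, 1]
    simp [add_comm]

/-- The diagonal torus of `SL(2, K)`. -/
def torusHom (K : Type*) [Field K] : Kˣ →* SL(2, K) where
  toFun y := ⟨!![(y : K), 0; 0, (y : K)⁻¹], by simp [Matrix.det_fin_two]⟩
  map_one' := by ext i j; fin_cases i <;> fin_cases j <;> simp
  map_mul' s t := by
    apply Subtype.ext
    change !![((s * t : Kˣ) : K), 0; 0, ((s * t : Kˣ) : K)⁻¹] =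
      !![(s : K), 0; 0, (s : K)⁻¹] * !![(t : K), 0; 0, (t : K)⁻¹]
    simp [mul_comm]

/-- The upper unipotent matrix with entry `t`. -/
def upper (t : K) : SL(2, K) := upperHom K (Multiplicative.ofAdd t)

theorem coe_upper (t : K) : (upper t : Matrix (Fin 2) (Fin 2) K) = !![1, t; 0, 1] := rfl

theorem coe_torusHom (y : Kˣ) :
    (torusHom K y : Matrix (Fin 2) (Fin 2) K) = !![(y : K), 0; 0, (y : K)⁻¹] := rfl

theorem upper_add (s t : K) : upper (s + t) = upper s * upper t := by
  simp [upper, ofAdd_add]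

theorem upper_zero : upper (0 : K) = 1 := by simp [upper]

theorem upper_neg (t : K) : upper (-t) = (upper t)⁻¹ := by simp [upper]

theorem torusHom_mul_upper (y : Kˣ) (t : K) :
    torusHom K y * upper t = upper ((y : K) ^ 2 * t) * torusHom K y := by
  apply Subtype.ext
  simp only [Matrix.SpecialLinearGroup.coe_mul, coe_upper, coe_torusHom, Matrix.mul_fin_two]
  congr! 3
  all_goals field_simp; try simp

theorem torusHom_inv_mul_upper (y : Kˣ) (t : K) :
    (torusHom K y)⁻¹ * upper t = upper (((y : K) ^ 2)⁻¹ * t) * (torusHom K y)⁻¹ := by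
  rw [← map_inv, torusHom_mul_upper]
  simp

/-- Modulo upper unipotents, conjugation by such a `g` inverts the torus. -/
theorem exists_commutator_torusHom_eq {g : SL(2, K)} (hg : g 0 0 = 0) (y : Kˣ) :
    ∃ s, g⁻¹ * ((torusHom K y)⁻¹ * g * torusHom K y) = upper s * torusHom K (y ^ 2) := by
  have hdet : g 0 1 * g 1 0 = -1 := by
    have := g.det_coe
    rw [Matrix.det_fin_two, hg] at this
    linear_combination -this
  refine ⟨g 1 1 * g 0 1 * (1 - (y : K) ^ 2), ?_⟩
  rw [inv_mul_eq_iff_eq_mul, mul_assoc, inv_mul_eq_iff_eq_mul]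
  have hgm : (g : Matrix (Fin 2) (Fin 2) K) = !![0, g 0 1; g 1 0, g 1 1] := by
    rw [← hg]; exact Matrix.eta_fin_two _
  apply Subtype.ext
  simp only [Matrix.SpecialLinearGroup.coe_mul, coe_upper, coe_torusHom]
  rw [hgm]
  generalize g 0 1 = q at *
  generalize g 1 0 = r at *
  generalize g 1 1 = d at *
  have hy : (y : K) ≠ 0 := y.ne_zero
  simp only [Matrix.mul_fin_two]
  ext i j
  fin_cases i <;> fin_cases j <;> simp <;> field_simp
  linear_combination (-d * (1 - (y:K)^2)) * hdet

theorem exists_upper_conj_apply_eq_zero {g : SL(2, K)} (hg : g 1 0 ≠ 0) :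
    ∃ s : K, (upper s * g * upper (-s)) 0 0 = 0 := by
  refine ⟨-(g 0 0 / g 1 0), ?_⟩
  simp only [Matrix.SpecialLinearGroup.coe_mul, coe_upper]
  rw [Matrix.eta_fin_two (g : Matrix (Fin 2) (Fin 2) K)]
  simp [hg]

/-- An additive subgroup of finite index of a field which is stable under infinitely many scalars
is everything. -/
theorem AddSubgroup.eq_top_of_infinite_stable (A : AddSubgroup K) [A.FiniteIndex] {R : Set K}
    (hR : R.Infinite) (hRA : ∀ r ∈ R, ∀ a ∈ A, r * a ∈ A) : A = ⊤ := by
  have : Finite (K ⧸ A) := AddSubgroup.finite_quotient_of_finiteIndex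
  have := hR.to_subtype
  -- Two of the infinitely many scalars act identically on the finite quotient, so their difference
  -- maps `K` into `A`.
  obtain ⟨r, s, hrs, h⟩ := Finite.exists_ne_map_eq_of_infinite
    fun (r : R) (q : K ⧸ A) => ((r * q.out : K) : K ⧸ A)
  have hne : (r : K) - s ≠ 0 := sub_ne_zero.2 fun h => hrs (Subtype.ext h)
  have hmem : ∀ t, ((r : K) - s) * t ∈ A := by
    intro t
    have h1 := congrFun h (t : K ⧸ A)
    rw [QuotientAddGroup.eq] at h1
    have h2 : -(t : K ⧸ A).out + t ∈ A := by
      rw [← QuotientAddGroup.eq]; simp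
    have := A.sub_mem (A.sub_mem (hRA r r.2 _ h2) (hRA s s.2 _ h2)) h1
    convert this using 1
    ring
  refine (AddSubgroup.eq_top_iff' _).2 fun t => ?_
  have := hmem (((r : K) - s)⁻¹ * t)
  rwa [mul_inv_cancel_left₀ hne] at this

/-- The parameters of the upper unipotent elements of a subgroup of `SL(2, K)`. -/
def upperPart (Γ : Subgroup SL(2, K)) : AddSubgroup K where
  carrier := {t | upper t ∈ Γ}
  zero_mem' := by simp [upper_zero, Γ.one_mem]
  add_mem' {s t} hs ht := by
    simp only [Set.mem_ofPred_eq] at *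
    rw [upper_add]; exact Γ.mul_mem hs ht
  neg_mem' {t} ht := by
    simp only [Set.mem_ofPred_eq] at *
    rw [upper_neg]; exact Γ.inv_mem ht

theorem mem_upperPart {Γ : Subgroup SL(2, K)} {t : K} : t ∈ upperPart Γ ↔ upper t ∈ Γ := Iff.rfl

/-- The diagonal parts of the upper triangular elements of a subgroup of `SL(2, K)`. -/
def torusPart (Γ : Subgroup SL(2, K)) : Subgroup Kˣ where
  carrier := {y | ∃ s, upper s * torusHom K y ∈ Γ}
  one_mem' := ⟨0, by simp [upper_zero, Γ.one_mem]⟩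
  mul_mem' {y z} := by
    rintro ⟨s, hs⟩ ⟨t, ht⟩
    refine ⟨s + (y : K) ^ 2 * t, ?_⟩
    convert Γ.mul_mem hs ht using 1
    rw [upper_add, map_mul, mul_assoc, mul_assoc, ← mul_assoc (torusHom K y) (upper t),
      torusHom_mul_upper, mul_assoc]
  inv_mem' {y} := by
    rintro ⟨s, hs⟩
    refine ⟨((y : K) ^ 2)⁻¹ * (-s), ?_⟩
    convert Γ.inv_mem hs using 1
    rw [mul_inv_rev, ← upper_neg, torusHom_inv_mul_upper, map_inv]

theorem mem_torusPart {Γ : Subgroup SL(2, K)} {y : Kˣ} :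
    y ∈ torusPart Γ ↔ ∃ s, upper s * torusHom K y ∈ Γ := Iff.rfl

theorem sq_mul_mem_upperPart {Γ : Subgroup SL(2, K)} {y : Kˣ} (hy : y ∈ torusPart Γ) {t : K}
    (ht : t ∈ upperPart Γ) : (y : K) ^ 2 * t ∈ upperPart Γ := by
  obtain ⟨s, hs⟩ := hy
  rw [mem_upperPart] at *
  convert Γ.mul_mem (Γ.mul_mem hs ht) (Γ.inv_mem hs) using 1
  rw [mul_assoc (upper s), torusHom_mul_upper, mul_inv_rev, ← mul_assoc, ← mul_assoc,
    mul_inv_cancel_right, ← upper_neg, ← upper_add, ← upper_add]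
  ring_nf

theorem infinite_of_finiteIndex_units [Infinite K] (W : Subgroup Kˣ) [W.FiniteIndex] :
    (W : Set Kˣ).Infinite := by
  have : Infinite Kˣ := unitsEquivNeZero.symm.infinite_iff.1
    (Set.infinite_coe_iff.2 (Set.finite_singleton (0 : K)).infinite_compl)
  intro hfin
  have : Finite W := hfin
  have hmul := W.card_mul_index
  rw [Nat.card_eq_zero_of_infinite (α := Kˣ), mul_eq_zero] at hmul
  exact hmul.elim Nat.card_pos.ne' Subgroup.FiniteIndex.index_ne_zero

theorem infinite_image_pow_four {W : Set Kˣ} (hW : W.Infinite) :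
    ((fun y : Kˣ => (y : K) ^ 4) '' W).Infinite := by
  classical
  refine fun hfin => hW (Set.Finite.of_finite_fibers (fun y : Kˣ => (y : K) ^ 4) hfin ?_)
  intro c _
  refine Set.Finite.subset (s := Units.val ⁻¹' ((Polynomial.nthRoots 4 c).toFinset : Set K))
    ((Finset.finite_toSet _).preimage Units.val_injective.injOn) ?_
  intro y hy
  have h4 : (y : K) ^ 4 = c := hy.2
  simpa [Polynomial.mem_nthRoots] using h4

/-- If `y ^ 2` is in the torus part, conjugation scales the upper part by `y ^ 4`. These scalars are
infinitely many, and one different from `1` triggers `hU`. -/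
theorem upperPart_eq_top [Infinite K] {Γ : Subgroup SL(2, K)}
    (hT : ((torusPart Γ).comap (powMonoidHom 2)).FiniteIndex)
    (hU : ∀ (s : K) (y : Kˣ), (y : K) ^ 2 ≠ 1 → upper s * torusHom K y ∈ Γ →
      (upperPart Γ).FiniteIndex) : upperPart Γ = ⊤ := by
  have hR := infinite_image_pow_four (infinite_of_finiteIndex_units
    ((torusPart Γ).comap (powMonoidHom 2)))
  have hRA : ∀ r ∈ (fun y : Kˣ => (y : K) ^ 4) '' ((torusPart Γ).comap (powMonoidHom 2)),
      ∀ a ∈ upperPart Γ, r * a ∈ upperPart Γ := by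
    rintro _ ⟨y, hy, rfl⟩ a ha
    have := sq_mul_mem_upperPart (show y ^ 2 ∈ torusPart Γ from hy) ha
    rwa [Units.val_pow_eq_pow_val, ← pow_mul, show 2 * 2 = 4 from rfl] at this
  obtain ⟨r, hrR, hr⟩ := hR.exists_notMem_finite (Set.finite_singleton (1 : K))
  obtain ⟨y, hy, hyr⟩ := (Set.mem_image _ _ _).1 hrR
  have hy2 : y ^ 2 ∈ torusPart Γ := hy
  obtain ⟨s, hs⟩ := mem_torusPart.1 hy2
  have : (upperPart Γ).FiniteIndex := hU s (y ^ 2) (by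
    rw [Units.val_pow_eq_pow_val, ← pow_mul]
    rwa [← hyr] at hr) hs
  exact AddSubgroup.eq_top_of_infinite_stable _ hR hRA

variable {G X : Type*} [Group G] [MulAction G X] [MeasurableSpace X] [MeasurableConstSMul G X]
  {μ : Measure X} [SMulInvariantMeasure G X μ] [IsFiniteMeasure μ] [Countable K]
  {ρ : SL(2, K) →* G} {Λ : X → Subgroup SL(2, K)}

/-- A return under the torus element `y` gives a commutator with diagonal part `y ^ 2`, whence the
pullback by squaring. -/
theorem IsRandomSubgroup.ae_torusPart_comap_finiteIndex (hΛ : IsRandomSubgroup ρ Λ)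
    {g : SL(2, K)} (hg : g 0 0 = 0) :
    ∀ᵐ x ∂μ, g ∈ Λ x → ((torusPart (Λ x)).comap (powMonoidHom 2)).FiniteIndex := by
  have : Countable Kˣ := Units.val_injective.countable
  refine ae_finiteIndex_of_return (ρ.comp (torusHom K)) (F := {x | g ∈ Λ x}) ?_ ?_
    (hΛ.measurableSet_mem g) ?_
  · intro y
    simp only [Subgroup.mem_comap, mem_torusPart, Set.ofPred_exists]
    exact MeasurableSet.iUnion fun s => hΛ.measurableSet_mem _
  · intro w x
    ext y
    simp only [Subgroup.mem_comap, mem_torusPart, MonoidHom.comp_apply, hΛ.mem_smul]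
    have h : ∀ s, (torusHom K w)⁻¹ * (upper s * torusHom K (y ^ 2)) * torusHom K w =
        upper (((w : K) ^ 2)⁻¹ * s) * torusHom K (y ^ 2) := by
      intro s
      rw [← mul_assoc, torusHom_inv_mul_upper, mul_assoc, mul_assoc, ← map_mul, mul_comm (y ^ 2) w,
        map_mul, inv_mul_cancel_left]
    simp only [powMonoidHom_apply, h]
    constructor
    · rintro ⟨s, hs⟩
      exact ⟨_, hs⟩
    · rintro ⟨s, hs⟩
      exact ⟨(w : K) ^ 2 * s, by simpa using hs⟩
  · intro x hx y hy
    simp only [MonoidHom.comp_apply, Set.mem_ofPred_eq, hΛ.mem_smul] at hx hy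
    obtain ⟨s, hs⟩ := exists_commutator_torusHom_eq hg y
    refine ⟨s, ?_⟩
    rw [powMonoidHom_apply, ← hs]
    exact mul_mem (inv_mem hx) hy

/-- The commutator with `upper t` is `upper (κ * t)`, where `κ = 1 - y⁻²` is invertible. -/
theorem IsRandomSubgroup.ae_upperPart_finiteIndex (hΛ : IsRandomSubgroup ρ Λ)
    (s : K) {y : Kˣ} (hy : (y : K) ^ 2 ≠ 1) :
    ∀ᵐ x ∂μ, upper s * torusHom K y ∈ Λ x → (upperPart (Λ x)).FiniteIndex := by
  have hκ : 1 - ((y : K) ^ 2)⁻¹ ≠ 0 := by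
    rw [sub_ne_zero]
    intro h
    exact hy (inv_eq_one.1 h.symm)
  set κ : K := 1 - ((y : K) ^ 2)⁻¹ with hκdef
  let V : X → Subgroup (Multiplicative K) := fun x =>
    AddSubgroup.toSubgroup ((upperPart (Λ x)).comap (AddMonoidHom.mulLeft κ))
  have : Countable (Multiplicative K) := ‹Countable K›
  have hmem : ∀ t x, t ∈ V x ↔ upper (κ * t.toAdd) ∈ Λ x := fun t x => Iff.rfl
  have hae := ae_finiteIndex_of_return (μ := μ) (ρ.comp (upperHom K)) (V := V)
    (F := {x | upper s * torusHom K y ∈ Λ x}) (fun t => hΛ.measurableSet_mem _) (by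
      intro w x
      ext t
      have hc : (upperHom K w)⁻¹ * upper (κ * t.toAdd) * upperHom K w = upper (κ * t.toAdd) := by
        rw [show upperHom K w = upper w.toAdd from rfl, ← upper_neg, ← upper_add, ← upper_add]
        ring_nf
      rw [hmem, hmem, MonoidHom.comp_apply, hΛ.mem_smul, hc]) (hΛ.measurableSet_mem _) (by
      intro x hx t ht
      rw [hmem]
      simp only [MonoidHom.comp_apply, Set.mem_ofPred_eq, hΛ.mem_smul] at hx ht
      have hc : upper (κ * t.toAdd) = (upper s * torusHom K y)⁻¹ *
          ((upperHom K t)⁻¹ * (upper s * torusHom K y) * upperHom K t) := by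
        have he : (upper s)⁻¹ * ((upper t.toAdd)⁻¹ * upper s) = upper (-t.toAdd) := by
          rw [← upper_neg, ← upper_neg, ← upper_add, ← upper_add]
          ring_nf
        rw [show upperHom K t = upper t.toAdd from rfl]
        calc upper (κ * t.toAdd)
            = (torusHom K y)⁻¹ * upper (-t.toAdd) * torusHom K y * upper t.toAdd := by
              rw [torusHom_inv_mul_upper, inv_mul_cancel_right, ← upper_add, hκdef]
              ring_nf
          _ = _ := by rw [← he]; group
      rw [hc]
      exact mul_mem (inv_mem hx) ht)
  filter_upwards [hae] with x hx hxs
  have h1 : ((upperPart (Λ x)).comap (AddMonoidHom.mulLeft κ)).FiniteIndex := by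
    have := hx hxs
    exact ⟨fun h => this.index_ne_zero (by simpa [V] using h)⟩
  refine ⟨?_⟩
  rw [← AddSubgroup.index_comap_of_surjective (upperPart (Λ x)) (f := AddMonoidHom.mulLeft κ)
    (fun t => ⟨κ⁻¹ * t, by simp [hκ]⟩)]
  exact h1.index_ne_zero

theorem IsRandomSubgroup.ae_upper_mem_of_apply_eq_zero [Infinite K] (hΛ : IsRandomSubgroup ρ Λ)
    {g : SL(2, K)} (hg : g 0 0 = 0) :
    ∀ᵐ x ∂μ, g ∈ Λ x → ∀ t, upper t ∈ Λ x := by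
  have h2 : ∀ᵐ x ∂μ, ∀ (s : K) (y : Kˣ), (y : K) ^ 2 ≠ 1 →
      upper s * torusHom K y ∈ Λ x → (upperPart (Λ x)).FiniteIndex := by
    have : Countable Kˣ := Units.val_injective.countable
    refine ae_all_iff.2 fun s => ae_all_iff.2 fun y => ?_
    by_cases hy : (y : K) ^ 2 = 1
    · simp [hy]
    · filter_upwards [hΛ.ae_upperPart_finiteIndex (μ := μ) s hy] with x hx _ using hx
  filter_upwards [hΛ.ae_torusPart_comap_finiteIndex (μ := μ) hg, h2] with x hx1 hx2 hxg
  intro t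
  rw [← mem_upperPart, upperPart_eq_top (hx1 hxg) hx2]
  exact AddSubgroup.mem_top t

/-- Almost everywhere on the event that `Λ x` contains a given matrix which is not upper
triangular, `Λ x` contains all upper unipotent matrices. -/
theorem IsRandomSubgroup.ae_upper_mem [Infinite K] (hΛ : IsRandomSubgroup ρ Λ)
    {g : SL(2, K)} (hg : g 1 0 ≠ 0) :
    ∀ᵐ x ∂μ, g ∈ Λ x → ∀ t, upper t ∈ Λ x := by
  obtain ⟨s, hs⟩ := exists_upper_conj_apply_eq_zero hg
  -- Apply the special case at the translated point; conjugation by `upper s` fixes all upper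
  -- unipotents.
  have h := (measurePreserving_smul (ρ (upper s)) μ).quasiMeasurePreserving.ae
    (hΛ.ae_upper_mem_of_apply_eq_zero (μ := μ) hs)
  filter_upwards [h] with x hx hxg t
  simp only [hΛ.mem_smul, upper_neg] at hx
  have := hx (by simpa [mul_assoc] using hxg) t
  rwa [← upper_neg, ← upper_add, ← upper_add, neg_add_cancel_comm] at this

end RankOne

/-! ### From `SL(2, K)` to `SL n K` by transvections. -/

section HigherRank

open Matrix

variable {n K : Type*} [Field K]

theorem mul_vecMulVec_add_of_mul (v v' f f' : n → K) (A : Matrix (Fin 2) (Fin 2) K) :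
    (of ![v, v'])ᵀ * A * of ![f', f] = A 0 0 • vecMulVec v f' + A 0 1 • vecMulVec v f +
      A 1 0 • vecMulVec v' f' + A 1 1 • vecMulVec v' f := by
  ext i j
  simp [Matrix.mul_apply, Fin.sum_univ_two, vecMulVec_apply]
  ring

theorem of_mul_of_transpose_eq_one [Fintype n] {v v' f f' : n → K} (h1 : f' ⬝ᵥ v = 1)
    (h2 : f' ⬝ᵥ v' = 0)
    (h3 : f ⬝ᵥ v = 0) (h4 : f ⬝ᵥ v' = 1) : of ![f', f] * (of ![v, v'])ᵀ = 1 := by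
  ext i j
  fin_cases i <;> fin_cases j <;> simp [Matrix.mul_apply'] <;> assumption

variable [Fintype n] [DecidableEq n]

/-- The embedding of `SL(2, K)` given by two vectors (the columns of `B`) and dual covectors
(the rows of `C`). -/
def blockHom (B : Matrix n (Fin 2) K) (C : Matrix (Fin 2) n K) (h : C * B = 1) :
    SL(2, K) →* Matrix.SpecialLinearGroup n K where
  toFun A := ⟨1 + B * ((A : Matrix (Fin 2) (Fin 2) K) - 1) * C, by
    rw [Matrix.mul_assoc, det_one_add_mul_comm, Matrix.mul_assoc, h]
    simp⟩
  map_one' := Subtype.ext (by simp)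
  map_mul' A A' := by
    apply Subtype.ext
    change 1 + B * ((A : Matrix (Fin 2) (Fin 2) K) * (A' : Matrix (Fin 2) (Fin 2) K) - 1) * C =
      (1 + B * ((A : Matrix (Fin 2) (Fin 2) K) - 1) * C) *
        (1 + B * ((A' : Matrix (Fin 2) (Fin 2) K) - 1) * C)
    have h1 : B * ((A : Matrix (Fin 2) (Fin 2) K) - 1) * C *
        (B * ((A' : Matrix (Fin 2) (Fin 2) K) - 1) * C) =
        B * (((A : Matrix (Fin 2) (Fin 2) K) - 1) * ((A' : Matrix (Fin 2) (Fin 2) K) - 1)) * C := by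
      calc _ = B * ((A : Matrix (Fin 2) (Fin 2) K) - 1) * (C * B) *
            ((A' : Matrix (Fin 2) (Fin 2) K) - 1) * C := by simp only [Matrix.mul_assoc]
        _ = _ := by rw [h, Matrix.mul_one]; simp only [Matrix.mul_assoc]
    rw [add_mul, mul_add, mul_add, h1, one_mul, one_mul, mul_one, add_assoc,
      ← add_assoc (B * _ * C), add_comm (B * _ * C), ← Matrix.add_mul, ← Matrix.add_mul, ← Matrix.mul_add, ← Matrix.mul_add]
    congr 4
    noncomm_ring

theorem coe_blockHom {B : Matrix n (Fin 2) K} {C : Matrix (Fin 2) n K} (h : C * B = 1)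
    (A : SL(2, K)) : (blockHom B C h A : Matrix n n K) =
      1 + B * ((A : Matrix (Fin 2) (Fin 2) K) - 1) * C := rfl

/-- The one-parameter group of transvections with direction `v` and kernel `f`. -/
def transvHom (v f : n → K) (h : f ⬝ᵥ v = 0) :
    Multiplicative K →* Matrix.SpecialLinearGroup n K where
  toFun t := ⟨1 + t.toAdd • vecMulVec v f, by
    rw [← smul_vecMulVec, vecMulVec_eq Unit, det_one_add_replicateCol_mul_replicateRow]
    simp [h]⟩
  map_one' := Subtype.ext (by simp)
  map_mul' s t := by
    apply Subtype.ext
    change 1 + (s.toAdd + t.toAdd) • vecMulVec v f =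
      (1 + s.toAdd • vecMulVec v f) * (1 + t.toAdd • vecMulVec v f)
    simp [add_mul, mul_add, vecMulVec_mul_vecMulVec, h, add_smul, add_assoc]

/-- The transvection with direction `v` and kernel `f`. -/
def transv (v f : n → K) (h : f ⬝ᵥ v = 0) (t : K) : Matrix.SpecialLinearGroup n K :=
  transvHom v f h (Multiplicative.ofAdd t)

theorem coe_transv {v f : n → K} (h : f ⬝ᵥ v = 0) (t : K) :
    (transv v f h t : Matrix n n K) = 1 + t • vecMulVec v f := rfl

theorem transv_neg {v f : n → K} (h : f ⬝ᵥ v = 0) (t : K) :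
    transv v f h (-t) = (transv v f h t)⁻¹ := by
  simp [transv]

/-- The commutator of `g` with a transvection lies in a copy of `SL(2, K)` in which the
transvections with the same direction and kernel are the upper unipotent matrices. -/
theorem exists_blockHom_eq_commutator {g : Matrix.SpecialLinearGroup n K} {v f : n → K}
    (h : f ⬝ᵥ v = 0) (h1 : f ⬝ᵥ (g.1 *ᵥ v) ≠ 0) (h2 : f ⬝ᵥ ((g⁻¹).1 *ᵥ v) ≠ 0) :
    ∃ σ : SL(2, K) →* Matrix.SpecialLinearGroup n K, (∀ t, σ (upper t) = transv v f h t) ∧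
      ∀ t : K, t ≠ 0 → ∃ A : SL(2, K), A 1 0 ≠ 0 ∧
        σ A = g⁻¹ * ((transv v f h t)⁻¹ * g * transv v f h t) := by
  have hgi : (g⁻¹).1 * g.1 = 1 := by
    rw [← Matrix.SpecialLinearGroup.coe_mul, inv_mul_cancel, Matrix.SpecialLinearGroup.coe_one]
  have hgi' : g.1 * (g⁻¹).1 = 1 := by
    rw [← Matrix.SpecialLinearGroup.coe_mul, mul_inv_cancel, Matrix.SpecialLinearGroup.coe_one]
  -- Conjugating the transvection by `g⁻¹` gives direction `w` and covector `p`.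
  set w := (g⁻¹).1 *ᵥ v with hw
  set p := f ᵥ* g.1 with hp
  rw [dotProduct_mulVec, ← hp] at h1
  have hpw : p ⬝ᵥ w = 0 := by
    rw [hp, hw, ← dotProduct_mulVec, mulVec_mulVec, hgi', one_mulVec, h]
  have hCB : of ![(p ⬝ᵥ v)⁻¹ • p, f] * (of ![v, (f ⬝ᵥ w)⁻¹ • w])ᵀ = 1 :=
    of_mul_of_transpose_eq_one (by simp [h1]) (by simp [hpw]) h (by simp [h2])
  refine ⟨blockHom _ _ hCB, fun t => ?_, fun t ht => ?_⟩
  · apply Subtype.ext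
    rw [coe_blockHom, mul_vecMulVec_add_of_mul, coe_upper, coe_transv]
    simp
  -- `A` is the product of the transvections `1 - t w p` and `1 + t v f`, expanded in the normalized
  -- vectors and covectors.
  · obtain ⟨A, hA⟩ : ∃ A : SL(2, K), (A : Matrix (Fin 2) (Fin 2) K) =
        !![1, t; -t * ((f ⬝ᵥ w) * (p ⬝ᵥ v)), 1 - t ^ 2 * ((f ⬝ᵥ w) * (p ⬝ᵥ v))] :=
      ⟨⟨_, by rw [det_fin_two_of]; ring⟩, rfl⟩
    refine ⟨A, ?_, ?_⟩
    · rw [hA]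
      change -t * ((f ⬝ᵥ w) * (p ⬝ᵥ v)) ≠ 0
      exact mul_ne_zero (neg_ne_zero.2 ht) (mul_ne_zero h2 h1)
    · apply Subtype.ext
      have hconj : (g⁻¹).1 * (1 + (-t) • vecMulVec v f) * g.1 = 1 + (-t) • vecMulVec w p := by
        rw [Matrix.mul_add, Matrix.add_mul, Matrix.mul_one, hgi, Matrix.mul_smul, Matrix.smul_mul,
          mul_vecMulVec, vecMulVec_mul]
      rw [coe_blockHom, mul_vecMulVec_add_of_mul, hA, ← transv_neg,
        Matrix.SpecialLinearGroup.coe_mul, Matrix.SpecialLinearGroup.coe_mul,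
        Matrix.SpecialLinearGroup.coe_mul,
        coe_transv, coe_transv, ← Matrix.mul_assoc, ← Matrix.mul_assoc, hconj]
      simp only [Matrix.add_mul, Matrix.mul_add, Matrix.smul_mul, Matrix.mul_smul,
        vecMulVec_mul_vecMulVec, Matrix.one_mul, Matrix.mul_one]
      ext i j
      simp [vecMulVec_apply]
      field_simp
      ring

/-- In the quotient by `v` both vectors are nonzero, and some functional vanishes at neither. -/
theorem exists_dotProduct_ne_zero [Infinite K] {v w w' : n → K} (h : w ∉ K ∙ v) (h' : w' ∉ K ∙ v) :
    ∃ f : n → K, f ⬝ᵥ v = 0 ∧ f ⬝ᵥ w ≠ 0 ∧ f ⬝ᵥ w' ≠ 0 := by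
  obtain ⟨φ, hφ⟩ := Module.exists_dual_forall_apply_ne_zero (K := K)
    ![(K ∙ v).mkQ w, (K ∙ v).mkQ w'] (by
      intro i
      fin_cases i <;> simpa [Submodule.Quotient.mk_eq_zero])
  have hf : ∀ u, (fun i => φ ((K ∙ v).mkQ (Pi.single i 1))) ⬝ᵥ u = φ ((K ∙ v).mkQ u) := by
    intro u
    conv_rhs => rw [pi_eq_sum_univ' u]
    simp [dotProduct, mul_comm]
  refine ⟨fun i => φ ((K ∙ v).mkQ (Pi.single i 1)), ?_, ?_, ?_⟩
  · rw [hf, Submodule.mkQ_apply, (Submodule.Quotient.mk_eq_zero _).2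
      (Submodule.mem_span_singleton_self v), map_zero]
  · rw [hf]; exact hφ 0
  · rw [hf]; exact hφ 1

theorem exists_notMem_span_of_notMem_center {g : Matrix.SpecialLinearGroup n K}
    (hg : g ∉ Subgroup.center (Matrix.SpecialLinearGroup n K)) : ∃ v : n → K, g.1 *ᵥ v ∉ K ∙ v := by
  by_contra! hcon
  apply hg
  rw [Matrix.SpecialLinearGroup.mem_center_iff]
  obtain ⟨a, ha⟩ := (Matrix.toLin' g.1).exists_eq_smul_id_of_forall_notLinearIndependent fun v ↦ by
      by_cases hv : v = 0
      · simp [hv, linearIndependent_fin2]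
      · simpa [LinearIndependent.pair_iff' hv, Submodule.mem_span_singleton] using hcon v
  have hscalar : Matrix.scalar n a = g.1 := by
    apply Matrix.toLin'.injective
    rw [ha]
    ext
    simp [Pi.single_apply]
  exact ⟨a, by simpa [← hscalar] using g.2, hscalar⟩

theorem exists_dotProduct_mulVec_ne_zero [Infinite K] {g : Matrix.SpecialLinearGroup n K}
    (hg : g ∉ Subgroup.center (Matrix.SpecialLinearGroup n K)) :
    ∃ v f : n → K, f ⬝ᵥ v = 0 ∧ f ⬝ᵥ (g.1 *ᵥ v) ≠ 0 ∧ f ⬝ᵥ ((g⁻¹).1 *ᵥ v) ≠ 0 := by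
  obtain ⟨v, hv⟩ := exists_notMem_span_of_notMem_center hg
  refine ⟨v, exists_dotProduct_ne_zero hv fun hv' => hv ?_⟩
  obtain ⟨c, hc⟩ := Submodule.mem_span_singleton.1 hv'
  have hgi' : g.1 * (g⁻¹).1 = 1 := by
    rw [← Matrix.SpecialLinearGroup.coe_mul, mul_inv_cancel, Matrix.SpecialLinearGroup.coe_one]
  have h1 : c • (g.1 *ᵥ v) = v := by
    rw [← mulVec_smul, hc, mulVec_mulVec, hgi', one_mulVec]
  have hc0 : c ≠ 0 := by
    rintro rfl
    rw [zero_smul] at h1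
    exact hv (by simp [← h1])
  exact Submodule.mem_span_singleton.2 ⟨c⁻¹, by rw [inv_smul_eq_iff₀ hc0, h1]⟩

theorem transv_eq_one_of_eq_zero {v f : n → K} (h : f ⬝ᵥ v = 0) (h0 : v = 0 ∨ f = 0) (t : K) :
    transv v f h t = 1 := by
  apply Subtype.ext
  rw [coe_transv]
  rcases h0 with rfl | rfl <;> simp

/-- A subgroup of `SL n K` containing all transvections is everything. -/
theorem eq_top_of_forall_transv_mem [Nontrivial n] {N : Subgroup (Matrix.SpecialLinearGroup n K)}
    (hN : ∀ (v f : n → K) (h : f ⬝ᵥ v = 0) (t : K), transv v f h t ∈ N) : N = ⊤ := by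
  refine (Subgroup.eq_top_iff' N).2 fun M => ?_
  refine Matrix.SpecialLinearGroup.diagonal_transvection_induction' (· ∈ N) M ?_ ?_
    fun _ _ => N.mul_mem
  · intro i j hij c hc
    -- The diagonal generator lies in the `SL(2, K)` of coordinates `i` and `j`, itself generated by
    -- transvections.
    have hCB : of ![Pi.single i (1 : K), Pi.single j 1] *
        (of ![Pi.single i (1 : K), Pi.single j 1])ᵀ = 1 := of_mul_of_transpose_eq_one (by simp) (by simp [hij]) (by simp [hij.symm]) (by simp)
    have hblock : ∀ A, blockHom _ _ hCB A ∈ N := by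
      refine SL2.transvection_induction _ ?_ fun A B hA hB => ?_
      · intro a b hab c
        have hab' : (![Pi.single i (1 : K), Pi.single j 1] b) ⬝ᵥ
            (![Pi.single i (1 : K), Pi.single j 1] a) = 0 := by
          fin_cases a <;> fin_cases b <;> simp_all
        convert hN _ _ hab' c
        apply Subtype.ext
        rw [coe_blockHom, mul_vecMulVec_add_of_mul, Matrix.SpecialLinearGroup.transvection_coe,
          coe_transv]
        fin_cases a <;> fin_cases b <;> simp_all
      · rw [map_mul]; exact N.mul_mem hA hB
    convert hblock (Matrix.SpecialLinearGroup.diag2 c hc)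
    apply Subtype.ext
    rw [coe_blockHom, mul_vecMulVec_add_of_mul, Matrix.SpecialLinearGroup.diag2_coe',
      Matrix.SpecialLinearGroup.diag2n_coe]
    ext k l
    by_cases hkl : k = l
    · subst hkl
      by_cases hki : k = i
      · subst hki; simp [vecMulVec_apply, hij]
      · by_cases hkj : k = j
        · subst hkj; simp [vecMulVec_apply, hij.symm]
        · simp [vecMulVec_apply, hki, hkj]
    · simp [hkl, vecMulVec_apply, Pi.single_apply]
      grind
  · intro i j hij a
    convert hN (Pi.single i 1) (Pi.single j 1) (by simp [hij]) a
    apply Subtype.ext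
    rw [Matrix.SpecialLinearGroup.transvection_coe, coe_transv, ← single_eq_single_vecMulVec_single]
    simp

variable {G X : Type*} [Group G] [MulAction G X] [MeasurableSpace X] [MeasurableConstSMul G X]
  {μ : Measure X} [SMulInvariantMeasure G X μ] [IsFiniteMeasure μ] [Countable K] [Infinite K]
  {ρ : Matrix.SpecialLinearGroup n K →* G} {Λ : X → Subgroup (Matrix.SpecialLinearGroup n K)}

theorem IsRandomSubgroup.ae_transv_mem (hΛ : IsRandomSubgroup ρ Λ)
    {g : Matrix.SpecialLinearGroup n K} {v f : n → K}
    (h : f ⬝ᵥ v = 0) (h1 : f ⬝ᵥ (g.1 *ᵥ v) ≠ 0) (h2 : f ⬝ᵥ ((g⁻¹).1 *ᵥ v) ≠ 0) :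
    ∀ᵐ x ∂μ, g ∈ Λ x → ∀ t, transv v f h t ∈ Λ x := by
  have : Countable (Multiplicative K) := ‹Countable K›
  have : Infinite (Multiplicative K) := ‹Infinite K›
  obtain ⟨σ, hσ, hσA⟩ := exists_blockHom_eq_commutator h h1 h2
  have hrec := ae_exists_ne_one_smul_mem (μ := μ) (ρ.comp (transvHom v f h))
    (hΛ.measurableSet_mem g)
  have hblock : ∀ᵐ x ∂μ, ∀ t : K, t ≠ 0 →
      g⁻¹ * ((transv v f h t)⁻¹ * g * transv v f h t) ∈ Λ x → ∀ s, transv v f h s ∈ Λ x := by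
    refine ae_all_iff.2 fun t => ae_all_iff.2 fun ht => ?_
    obtain ⟨A, hA, hA'⟩ := hσA t ht
    filter_upwards [(hΛ.comap σ).ae_upper_mem (μ := μ) hA] with x hx
    simpa only [Subgroup.mem_comap, hA', hσ] using hx
  filter_upwards [hrec, hblock] with x hx hx' hxg
  obtain ⟨t, ht, htx⟩ := hx hxg
  simp only [MonoidHom.comp_apply, hΛ.mem_smul] at htx
  exact hx' t.toAdd (fun h0 => ht (by simpa using h0)) (mul_mem (inv_mem hxg) htx)

/-- For `g = transv v f h 1`, the pairing of `f'` with `g v'` is `(f' ⬝ᵥ v) * (f ⬝ᵥ v')`.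
Countability of `K` gives one null set for all data. -/
theorem IsRandomSubgroup.ae_transv_mem_of_transv_mem (hΛ : IsRandomSubgroup ρ Λ) :
    ∀ᵐ x ∂μ, ∀ (v f v' f' : n → K) (h : f ⬝ᵥ v = 0) (h' : f' ⬝ᵥ v' = 0),
      f ⬝ᵥ v' ≠ 0 → f' ⬝ᵥ v ≠ 0 → transv v f h 1 ∈ Λ x → ∀ t, transv v' f' h' t ∈ Λ x := by
  refine ae_all_iff.2 fun v => ae_all_iff.2 fun f => ae_all_iff.2 fun v' => ae_all_iff.2 fun f' =>
    ae_all_iff.2 fun h => ae_all_iff.2 fun h' => ae_all_iff.2 fun h1 => ae_all_iff.2 fun h2 => ?_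
  refine hΛ.ae_transv_mem h' ?_ ?_
  · rw [coe_transv]
    simp [add_mulVec, vecMulVec_mulVec, h', h1, h2]
  · rw [← transv_neg, coe_transv]
    simp [add_mulVec, neg_mulVec, vecMulVec_mulVec, h', h1, h2]

/-- Almost everywhere on the event that `Λ x` contains a given non-central matrix, `Λ x` is the
whole group. -/
theorem IsRandomSubgroup.ae_eq_top [Nontrivial n] (hΛ : IsRandomSubgroup ρ Λ)
    {g : Matrix.SpecialLinearGroup n K} (hg : g ∉ Subgroup.center (Matrix.SpecialLinearGroup n K)) :
    ∀ᵐ x ∂μ, g ∈ Λ x → Λ x = ⊤ := by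
  obtain ⟨v, f, h, h1, h2⟩ := exists_dotProduct_mulVec_ne_zero hg
  have hv0 : v ≠ 0 := by rintro rfl; simp at h1
  have hf0 : f ≠ 0 := by rintro rfl; simp at h1
  filter_upwards [hΛ.ae_transv_mem (μ := μ) h h1 h2, hΛ.ae_transv_mem_of_transv_mem (μ := μ)]
    with x hx hx' hxg
  refine eq_top_of_forall_transv_mem fun v' f' h' t => ?_
  by_cases h0 : v' = 0 ∨ f' = 0
  · rw [transv_eq_one_of_eq_zero h' h0]; exact one_mem _
  rw [not_or] at h0
  -- Two steps suffice, through a transvection with direction `w` off both kernels and covector `q`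
  -- nonzero at both `v` and `v'`.
  obtain ⟨w, -, hw, hw'⟩ := exists_dotProduct_ne_zero (v := 0) (w := f) (w' := f')
    (by simpa using hf0) (by simpa using h0.2)
  rw [dotProduct_comm] at hw hw'
  obtain ⟨q, hq0, hq, hq'⟩ := exists_dotProduct_ne_zero (v := w) (w := v) (w' := v')
    (fun hmem => by
      obtain ⟨c, rfl⟩ := Submodule.mem_span_singleton.1 hmem
      rw [dotProduct_smul, smul_eq_zero] at h
      rcases h with rfl | h
      · simp at hv0
      · exact hw h)
    (fun hmem => by
      obtain ⟨c, rfl⟩ := Submodule.mem_span_singleton.1 hmem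
      rw [dotProduct_smul, smul_eq_zero] at h'
      rcases h' with rfl | h'
      · simp at h0
      · exact hw' h')
  exact hx' w q v' f' hq0 h' hq' hw' (hx' v f w q h hq0 hw hq (hx hxg 1) 1) t

end HigherRank

/-! ### Descent to countable subfields and the zero-one law. -/

section Ergodic

open Matrix

variable {n k : Type*} [Fintype n] [DecidableEq n] [Field k]

theorem exists_map_subtype_eq {K : Subfield k} {g : Matrix.SpecialLinearGroup n k}
    (hg : ∀ i j, g i j ∈ K) :
    ∃ g' : Matrix.SpecialLinearGroup n K, Matrix.SpecialLinearGroup.map K.subtype g' = g := by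
  let M : Matrix n n K := fun i j => ⟨g i j, hg i j⟩
  have hM : K.subtype.mapMatrix M = g := rfl
  refine ⟨⟨M, ?_⟩, Subtype.ext hM⟩
  apply K.subtype_injective
  rw [RingHom.map_det, hM, map_one, g.det_coe]

theorem notMem_center_of_map_notMem_center {K : Type*} [Field K] (φ : K →+* k)
    {g : Matrix.SpecialLinearGroup n K}
    (hg : Matrix.SpecialLinearGroup.map φ g ∉ Subgroup.center (Matrix.SpecialLinearGroup n k)) :
    g ∉ Subgroup.center (Matrix.SpecialLinearGroup n K) := by
  intro h
  apply hg
  rw [Matrix.SpecialLinearGroup.mem_center_iff] at h ⊢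
  obtain ⟨r, hr, hrg⟩ := h
  refine ⟨φ r, by rw [← map_pow, hr, map_one], ?_⟩
  rw [Matrix.SpecialLinearGroup.map_apply_coe, ← hrg]
  ext i j
  by_cases hij : i = j <;> simp [hij]

variable [Infinite k]

theorem exists_countable_subfield (s : Set k) (hs : s.Countable) :
    ∃ K : Subfield k, Countable K ∧ Infinite K ∧ s ⊆ K := by
  let e := Infinite.natEmbedding k
  refine ⟨Subfield.closure (s ∪ Set.range e), ?_, ?_, ?_⟩
  · rw [← Cardinal.mk_le_aleph0_iff]
    refine (Subfield.cardinalMk_closure_le_max _).trans (max_le ?_ le_rfl)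
    exact Cardinal.mk_le_aleph0_iff.2 (hs.union (Set.countable_range e)).to_subtype
  · exact Infinite.of_injective
      (fun i : ℕ => (⟨e i, Subfield.subset_closure (Or.inr ⟨i, rfl⟩)⟩ :
        Subfield.closure (s ∪ Set.range e))) fun i j hij => e.injective (Subtype.ext_iff.1 hij)
  · exact Set.subset_union_left.trans Subfield.subset_closure

variable {G X : Type*} [Group G] [MulAction G X] [MeasurableSpace X] [MeasurableConstSMul G X]
  {μ : Measure X} {ρ : Matrix.SpecialLinearGroup n k →* G}
  {Λ : X → Subgroup (Matrix.SpecialLinearGroup n k)}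

theorem IsRandomSubgroup.ae_mem_of_mem [Nontrivial n] [SMulInvariantMeasure G X μ]
    [IsFiniteMeasure μ] (hΛ : IsRandomSubgroup ρ Λ) {g : Matrix.SpecialLinearGroup n k}
    (hg : g ∉ Subgroup.center (Matrix.SpecialLinearGroup n k))
    (h : Matrix.SpecialLinearGroup n k) : ∀ᵐ x ∂μ, g ∈ Λ x → h ∈ Λ x := by
  obtain ⟨K, hK, hK', hsub⟩ := exists_countable_subfield
    (Set.range (fun p : n × n => g p.1 p.2) ∪ Set.range (fun p : n × n => h p.1 p.2))
    ((Set.countable_range _).union (Set.countable_range _))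
  obtain ⟨g', rfl⟩ := exists_map_subtype_eq (K := K) (g := g)
    fun i j => hsub (Or.inl ⟨(i, j), rfl⟩)
  obtain ⟨h', rfl⟩ := exists_map_subtype_eq (K := K) (g := h)
    fun i j => hsub (Or.inr ⟨(i, j), rfl⟩)
  filter_upwards [(hΛ.comap (Matrix.SpecialLinearGroup.map K.subtype)).ae_eq_top (μ := μ)
    (notMem_center_of_map_notMem_center _ hg)] with x hx hxg
  have : h' ∈ (Λ x).comap (Matrix.SpecialLinearGroup.map K.subtype) := by
    rw [hx hxg]; exact Subgroup.mem_top _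
  exact this

/-- The zero-one law for random subgroups of `SL n k` that are ergodic: they contain either no
non-central element or every element, almost surely. -/
theorem IsRandomSubgroup.forall_measure_eq_zero_or_forall_ae_mem [Nontrivial n] [ErgodicSMul G X μ]
    [IsFiniteMeasure μ] (hρ : Function.Surjective ρ) (hΛ : IsRandomSubgroup ρ Λ) :
    (∀ g, g ∉ Subgroup.center (Matrix.SpecialLinearGroup n k) → μ {x | g ∈ Λ x} = 0) ∨
      ∀ g, ∀ᵐ x ∂μ, g ∈ Λ x := by
  by_cases hnull : ∀ g, g ∉ Subgroup.center (Matrix.SpecialLinearGroup n k) →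
      μ {x | g ∈ Λ x} = 0
  · exact Or.inl hnull
  push Not at hnull
  obtain ⟨g, hg, hpos⟩ := hnull
  have hconst : Filter.EventuallyConst {x | g ∈ Λ x} (ae μ) := by
    refine aeconst_of_forall_preimage_smul_ae_eq G (hΛ.measurableSet_mem g).nullMeasurableSet ?_
    intro a
    obtain ⟨b, rfl⟩ := hρ a
    have hconj : b⁻¹ * g * b ∉ Subgroup.center (Matrix.SpecialLinearGroup n k) := by
      intro hc
      apply hg
      have := (inferInstance : (Subgroup.center (Matrix.SpecialLinearGroup n k)).Normal).conj_mem
        _ hc b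
      simpa [mul_assoc] using this
    -- Noncentral elements imply each other's membership, so the event of `g` agrees almost
    -- everywhere with its translates.
    filter_upwards [hΛ.ae_mem_of_mem (μ := μ) hg (b⁻¹ * g * b),
      hΛ.ae_mem_of_mem (μ := μ) hconj g] with x h1 h2
    exact propext ((hΛ.mem_smul b g x).trans ⟨h2, h1⟩)
  rw [Filter.eventuallyConst_set'] at hconst
  right
  intro h
  rcases hconst with h0 | h1
  · exact absurd (measure_congr h0) (by simpa using hpos)
  · filter_upwards [h1, hΛ.ae_mem_of_mem (μ := μ) hg h] with x hx hx'
    exact hx' (hx.mpr trivial)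

/-- A point is fixed iff it and its image lie on the same side of every separating set. -/
theorem measurableSet_fixedBy [MeasurableSpace.CountablySeparated X] (g : G) :
    MeasurableSet (MulAction.fixedBy X g) := by
  obtain ⟨S, hS, hSm, hsep⟩ := (inferInstance : HasCountableSeparatingOn X MeasurableSet Set.univ).1
  have : MulAction.fixedBy X g = ⋂ s ∈ S, ((s ∩ (g • ·) ⁻¹' s) ∪ (sᶜ ∩ (g • ·) ⁻¹' sᶜ)) := by
    ext x
    simp only [MulAction.mem_fixedBy, Set.mem_iInter]
    constructor
    · intro hx s _
      by_cases hxs : x ∈ s <;> simp [hx, hxs]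
    · intro hx
      refine hsep _ trivial _ trivial fun s hs => ?_
      have := hx s hs
      simp only [Set.mem_union, Set.mem_inter_iff, Set.mem_preimage, Set.mem_compl_iff] at this
      tauto
  rw [this]
  exact MeasurableSet.biInter hS fun s hs =>
    ((hSm s hs).inter (measurable_const_smul g (hSm s hs))).union
      ((hSm s hs).compl.inter (measurable_const_smul g (hSm s hs).compl))

theorem isRandomSubgroup_stabilizer [MeasurableSpace.CountablySeparated X] :
    IsRandomSubgroup (MonoidHom.id G) fun x : X => MulAction.stabilizer G x where
  measurableSet_mem g := measurableSet_fixedBy g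
  mem_smul g h x := by
    simp only [MonoidHom.id_apply, MulAction.mem_stabilizer_iff, mul_smul, inv_smul_eq_iff]

end Ergodic

/-! ### Measures on the Chabauty space. -/

section Chabauty

variable {Γ : Type*} [Group Γ]

theorem isOpen_setOf_mem (g : Γ) : IsOpen {H : Subgroup Γ | g ∈ H} :=
  TopologicalSpace.isOpen_generateFrom_of_mem ⟨g, Or.inl rfl⟩

theorem isOpen_setOf_notMem (g : Γ) : IsOpen {H : Subgroup Γ | g ∉ H} :=
  TopologicalSpace.isOpen_generateFrom_of_mem ⟨g, Or.inr rfl⟩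

theorem mem_conjAct_smul_iff (g : ConjAct Γ) (h : Γ) (H : Subgroup Γ) :
    h ∈ g • H ↔ (ConjAct.ofConjAct g)⁻¹ * h * ConjAct.ofConjAct g ∈ H := by
  rw [Subgroup.mem_pointwise_smul_iff_inv_smul_mem, ConjAct.smul_def]
  simp

instance continuousConstSMul_conjAct_subgroup : ContinuousConstSMul (ConjAct Γ) (Subgroup Γ) where
  continuous_const_smul g := by
    refine continuous_generateFrom_iff.2 ?_
    rintro _ ⟨h, rfl | rfl⟩
    · simpa only [Set.preimage_ofPred_eq, mem_conjAct_smul_iff] using isOpen_setOf_mem _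
    · simpa only [Set.preimage_ofPred_eq, mem_conjAct_smul_iff] using isOpen_setOf_notMem _

theorem isRandomSubgroup_id : IsRandomSubgroup (ConjAct.toConjAct (G := Γ)).toMonoidHom
    (fun H : Subgroup Γ => H) where
  measurableSet_mem g := (isOpen_setOf_mem g).measurableSet
  mem_smul _ _ _ := mem_conjAct_smul_iff _ _ _

/-- Inner regularity and compactness replace countable additivity, so `Γ` may be uncountable. -/
theorem measure_iUnion_eq_zero_of_regular {X ι : Type*} [TopologicalSpace X] [MeasurableSpace X]
    {μ : Measure X} [μ.Regular] {U : ι → Set X} (hU : ∀ i, IsOpen (U i))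
    (h0 : ∀ i, μ (U i) = 0) : μ (⋃ i, U i) = 0 := by
  rw [(isOpen_iUnion hU).measure_eq_iSup_isCompact]
  simp only [ENNReal.iSup_eq_zero]
  intro C hC hCc
  obtain ⟨t, ht⟩ := hCc.elim_finite_subcover U hU hC
  exact measure_mono_null ht ((measure_biUnion_null_iff t.countable_toSet).2 fun i _ => h0 i)

theorem eq_dirac_of_measure_compl_eq_zero {X : Type*} [MeasurableSpace X] {μ : Measure X}
    [IsProbabilityMeasure μ] {a : X} (h : μ {a}ᶜ = 0) : μ = Measure.dirac a := by
  have hae : ∀ᵐ x ∂μ, x = a := h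
  ext s hs
  rw [Measure.dirac_apply' _ hs]
  by_cases ha : a ∈ s
  · rw [Set.indicator_of_mem ha, Pi.one_apply, ← measure_univ (μ := μ)]
    refine measure_congr ?_
    filter_upwards [hae] with x hx
    exact propext ⟨fun _ => trivial, fun _ => hx ▸ ha⟩
  · rw [Set.indicator_of_notMem ha]
    refine measure_mono_null (t := {a}ᶜ) (fun x hx => ?_) h
    rintro rfl
    exact ha hx

theorem eq_dirac_bot_of_forall_measure_eq_zero {μ : Measure (Subgroup Γ)} [IsProbabilityMeasure μ]
    [μ.Regular] (h : ∀ g : Γ, g ≠ 1 → μ {H | g ∈ H} = 0) : μ = Measure.dirac ⊥ := by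
  apply eq_dirac_of_measure_compl_eq_zero
  refine measure_mono_null ?_ (measure_iUnion_eq_zero_of_regular
    (U := fun g : {g : Γ // g ≠ 1} => {H : Subgroup Γ | g.1 ∈ H})
    (fun g => isOpen_setOf_mem g.1) fun g => h g.1 g.2)
  intro H hH
  obtain ⟨g, hg⟩ := Subgroup.ne_bot_iff_exists_ne_one.1 hH
  exact Set.mem_iUnion.2 ⟨⟨g.1, fun h => hg (Subtype.ext h)⟩, g.2⟩

theorem eq_dirac_top_of_forall_ae_mem {μ : Measure (Subgroup Γ)} [IsProbabilityMeasure μ]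
    [μ.Regular] (h : ∀ g : Γ, ∀ᵐ H ∂μ, g ∈ H) : μ = Measure.dirac ⊤ := by
  apply eq_dirac_of_measure_compl_eq_zero
  refine measure_mono_null ?_ (measure_iUnion_eq_zero_of_regular
    (U := fun g : Γ => {H : Subgroup Γ | g ∉ H}) (fun g => isOpen_setOf_notMem g) h)
  intro H hH
  by_contra hcon
  refine hH ((Subgroup.eq_top_iff' H).2 fun g => ?_)
  by_contra hg
  exact hcon (Set.mem_iUnion.2 ⟨g, hg⟩)

end Chabauty

/-! ### Both statements for `PSL(m, k)`. -/

theorem mainTheorem5 {k : Type*} [Field k] [Infinite k] (m : ℕ) (hm : 2 ≤ m) :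
    (∀ {X : Type*} [MeasurableSpace X] [MeasurableSpace.CountablySeparated X]
        [MulAction PSL(m, k) X] [MeasurableConstSMul PSL(m, k) X]
        (μ : Measure X) [IsProbabilityMeasure μ] [ErgodicSMul PSL(m, k) X μ],
        ¬ IsTrivialAction PSL(m, k) μ → IsEssentiallyFree PSL(m, k) μ) ∧
      (∀ μ : Measure (Subgroup PSL(m, k)), IsErgodicIRS μ →
        μ = Measure.dirac ⊥ ∨ μ = Measure.dirac ⊤) := by
  have : Nontrivial (Fin m) := Fin.nontrivial_iff_two_le.2 hm
  let π : SL(m, k) →* PSL(m, k) := QuotientGroup.mk' _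
  have hπ : Function.Surjective π := QuotientGroup.mk'_surjective _
  have hcenter : ∀ g : SL(m, k), π g ≠ 1 → g ∉ Subgroup.center SL(m, k) := fun g hg hc =>
    hg ((QuotientGroup.eq_one_iff g).2 hc)
  refine ⟨?_, ?_⟩
  · intro X _ _ _ _ μ _ _ htriv g hg
    obtain ⟨g, rfl⟩ := hπ g
    rcases ((isRandomSubgroup_stabilizer (G := PSL(m, k)) (X := X)).comap
      π).forall_measure_eq_zero_or_forall_ae_mem (μ := μ) hπ with h | h
    · exact h g (hcenter g hg)
    · refine absurd (fun g => ?_) htriv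
      obtain ⟨g, rfl⟩ := hπ g
      exact h g
  · intro μ hμ
    have := hμ.isProbabilityMeasure
    have := hμ.regular
    have := hμ.ergodic
    rcases ((isRandomSubgroup_id (Γ := PSL(m, k))).comap
      π).forall_measure_eq_zero_or_forall_ae_mem (μ := μ)
        ((ConjAct.toConjAct (G := PSL(m, k))).surjective.comp hπ) with h | h
    · left
      refine eq_dirac_bot_of_forall_measure_eq_zero fun g hg => ?_
      obtain ⟨g, rfl⟩ := hπ g
      exact h g (hcenter g hg)
    · right
      refine eq_dirac_top_of_forall_ae_mem fun g => ?_
      obtain ⟨g, rfl⟩ := hπ g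
      exact h g
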